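/- Let $G$ be an infinite countable group acting by homeomorphisms on a compact metrizable space $M$, and assume the following. - (Convergence group) For every sequence $(g_n)$ of distinct elements of $G$ there are a subsequence $(g_{n_k})$ and points $a,b\in M$ such that $g_{n_k}\to b$ locally uniformly on $M\setminus\{a\}$, i.e. for every compact $K\subset M\setminus\{a\}$ and every open $U\ni b$ one has $g_{n_k}K\subset U$ for all large $k$. - (Non-elementary) No $G$-invariant subset of $M$ consists of one or two points. - (Minimal) $M$ has no non-empty proper closed $G$-invariant subset. Let $\mu$ be a probability measure on $G$ whose support generates $G$ as a semigroup, and let $\nu$ be a $\mu$-stationary Borel probability measure on $M$, that is, $\nu(S)=\sum_{g\in G}\mu(g)\,\nu(g^{-1}S)$ for all Borel $S\subset M$. An annulus is an ordered pair $A=(A^-,A^+)$ of disjoint closed subsets of $M$ with $A^-\cup A^+\ne M$; put $-A=(A^+,A^-)$ and $gA=(gA^-,gA^+)$. For $K,L\subset M$ and annuli $A,B$ write $K<A$ if $K\subset\operatorname{int}A^-$, $A<L$ if $L\subset\operatorname{int}A^+$, and $A<B$ if $\operatorname{int}A^+\cup\operatorname{int}B^-=M$. For a set $\mathcal A$ of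 annuli let $(K|L)\in\{0,1,\dots,\infty\}$ be the supremum of all $n$ for which there is a chain $K<A_1<\dots<A_n<L$ with $A_i\in\mathcal A$ (it is $0$ if there is no such chain with $n\ge1$). Let $T\subset M^3$ be the space of triples of distinct points and, for $x,y\in T$, $$\rho(x,y)=\max\{(\{x^i,x^j\}|\{y^k,y^l\}) : i\ne j,\ k\ne l\}.$$ Give $T\cup M$ the topology generated by the open subsets of $T$ and the sets $\{x\in T: x\text{ has at least two components in }U\}\cup U$ with $U\subset M$ open. The finite boundary $M_F$ of $\mathcal A$ is the set of those $p\in M$ for which there are $x_0\in T$, a sequence $(x_n)$ in $T$ and $R<\infty$ such that $x_n\to p$ in $T\cup M$ and $\rho(x_0,x_n)\le R$ for all $n$. A point $p\in M$ is a conical limit point if there are distinct $a,b\in M$ and a sequence $(g_n)$ in $G$ with $g_np\to a$ and $g_nx\to b$ for every $x\in M\setminus\{p\}$. Then: 1. Let $g\in G$ fix two distinct points $a,b\in M$ and satisfy $g^n\to b$ locally uniformly on $M\setminus\{a\}$ as $n\to\infty$, and let $A$ be an annulus with $a\in\operatorname{int}A^-$ and $b\in\operatorname{int}A^+$. Then the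 finite boundary $M_F$ of the annulus system $\mathcal A=\{hA,\,h(-A): h\in G\}$ satisfies $\nu(M_F)=0$. 2. The set of points of $M$ that are not conical limit points has $\nu$-measure $0$. -/

import Mathlib

open Set Filter Topology MeasureTheory
open scoped ENNReal

namespace ConvergenceGroup

section Actions

/-- The maps `x ↦ h n • x` converge to the constant `b`, locally uniformly on `M \ {a}`. -/
def ConvergesOff {G M : Type*} [Group G] [TopologicalSpace M] [MulAction G M]
    (h : ℕ → G) (a b : M) : Prop :=
  ∀ K : Set M, IsCompact K → K ⊆ {a}ᶜ → ∀ U : Set M, IsOpen U → b ∈ U →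
    ∀ᶠ n in atTop, MapsTo (fun x => h n • x) K U

/-- The convergence property: every sequence of distinct group elements has a subsequence that
converges locally uniformly off a point `a` to a point `b`. -/
def IsConvergenceAction (G M : Type*) [Group G] [TopologicalSpace M] [MulAction G M] : Prop :=
  ∀ g : ℕ → G, Function.Injective g →
    ∃ k : ℕ → ℕ, StrictMono k ∧ ∃ a b : M, ConvergesOff (g ∘ k) a b

/-- No invariant subset consists of one or two points. -/
def IsNonElementary (G M : Type*) [Group G] [MulAction G M] : Prop :=
  ∀ S : Set M, S.Nonempty → S.encard ≤ 2 → ¬ ∀ (g : G), ∀ x ∈ S, g • x ∈ S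

/-- `g` fixes the two distinct points `a`, `b`, and `gⁿ` converges to `b` locally uniformly
off `a`. -/
def IsHyperbolicElement {G M : Type*} [Group G] [TopologicalSpace M] [MulAction G M]
    (g : G) (a b : M) : Prop :=
  a ≠ b ∧ g • a = a ∧ g • b = b ∧ ConvergesOff (fun n : ℕ => g ^ n) a b

/-- Conical limit points of the action of `G` on `M`. -/
def IsConicalLimitPoint (G : Type*) {M : Type*} [Group G] [TopologicalSpace M] [MulAction G M]
    (p : M) : Prop :=
  ∃ a b : M, a ≠ b ∧ ∃ g : ℕ → G,
    Tendsto (fun n => g n • p) atTop (𝓝 a) ∧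
    ∀ x : M, x ≠ p → Tendsto (fun n => g n • x) atTop (𝓝 b)

/-- `ν(S) = ∑_g μ(g) ν(g⁻¹ S)` for every measurable set `S`. -/
def IsStationary {G M : Type*} [Group G] [MeasurableSpace M] [MulAction G M]
    (μ : PMF G) (ν : Measure M) : Prop :=
  ∀ S : Set M, MeasurableSet S → ν S = ∑' g : G, μ g * ν ((fun x => g • x) ⁻¹' S)

end Actions

section Annuli

/-- An annulus: an ordered pair of disjoint closed sets that do not cover the space. -/
@[ext]
structure Annulus (M : Type*) [TopologicalSpace M] where
  /-- The set `A⁻`. -/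
  neg : Set M
  /-- The set `A⁺`. -/
  pos : Set M
  isClosed_neg : IsClosed neg
  isClosed_pos : IsClosed pos
  disjoint : Disjoint neg pos
  compl_nonempty : (neg ∪ pos)ᶜ.Nonempty

/-- The annulus `-A = (A⁺, A⁻)`. -/
def Annulus.swap {M : Type*} [TopologicalSpace M] (A : Annulus M) : Annulus M where
  neg := A.pos
  pos := A.neg
  isClosed_neg := A.isClosed_pos
  isClosed_pos := A.isClosed_neg
  disjoint := A.disjoint.symm
  compl_nonempty := by rw [union_comm]; exact A.compl_nonempty

/-- The annulus `gA = (gA⁻, gA⁺)`. -/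
def Annulus.translate {G M : Type*} [Group G] [TopologicalSpace M] [MulAction G M]
    [ContinuousConstSMul G M] (g : G) (A : Annulus M) : Annulus M where
  neg := (fun x => g • x) '' A.neg
  pos := (fun x => g • x) '' A.pos
  isClosed_neg := (Homeomorph.smul g).isClosedMap _ A.isClosed_neg
  isClosed_pos := (Homeomorph.smul g).isClosedMap _ A.isClosed_pos
  disjoint := (disjoint_image_iff (MulAction.injective g)).2 A.disjoint
  compl_nonempty := by
    rw [← image_union, ← image_compl_eq (MulAction.bijective g)]
    exact A.compl_nonempty.image _

/-- The annulus system generated by `A`: all translates of `A` and of `-A`. -/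
def annulusSystem (G : Type*) {M : Type*} [Group G] [TopologicalSpace M] [MulAction G M]
    [ContinuousConstSMul G M] (A : Annulus M) : Set (Annulus M) :=
  {B | ∃ g : G, B = A.translate g ∨ B = A.swap.translate g}

/-- The relation `A < B` between annuli: `int A⁺ ∪ int B⁻ = M`. -/
def Annulus.Precedes {M : Type*} [TopologicalSpace M] (A B : Annulus M) : Prop :=
  interior A.pos ∪ interior B.neg = univ

/-- `l = [A₁, …, Aₙ]` is a chain `K < A₁ < ⋯ < Aₙ < L` of annuli from the system `𝒜`,
where `K < A` means `K ⊆ int A⁻` and `A < L` means `L ⊆ int A⁺`.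
The empty list is always a chain. -/
def IsAnnulusChain {M : Type*} [TopologicalSpace M] (𝒜 : Set (Annulus M)) (K L : Set M)
    (l : List (Annulus M)) : Prop :=
  (∀ A ∈ l, A ∈ 𝒜) ∧
  (∀ A ∈ l.head?, K ⊆ interior A.neg) ∧
  l.IsChain Annulus.Precedes ∧
  (∀ A ∈ l.getLast?, L ⊆ interior A.pos)

/-- The number `(K|L) ∈ {0, 1, …, ∞}`: the supremum of the lengths of the chains of annuli
between `K` and `L`. -/
noncomputable def crossratio {M : Type*} [TopologicalSpace M] (𝒜 : Set (Annulus M))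
    (K L : Set M) : ℕ∞ :=
  ⨆ (l : List (Annulus M)) (_ : IsAnnulusChain 𝒜 K L l), (l.length : ℕ∞)

end Annuli

section Triples

/-- The space `T` of ordered triples of distinct points, with the topology induced by `M³`. -/
abbrev DistinctTriple (M : Type*) : Type _ :=
  {x : Fin 3 → M // Function.Injective x}

/-- The function `ρ((x¹,x²,x³),(y¹,y²,y³)) = max {(xⁱ,xʲ|yᵏ,yˡ) : i ≠ j, k ≠ l}` on `T²`. -/
noncomputable def tripleDist {M : Type*} [TopologicalSpace M] (𝒜 : Set (Annulus M))
    (x y : DistinctTriple M) : ℕ∞ :=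
  ⨆ (i : Fin 3) (j : Fin 3) (k : Fin 3) (l : Fin 3) (_ : i ≠ j) (_ : k ≠ l),
    crossratio 𝒜 {x.1 i, x.1 j} {y.1 k, y.1 l}

/-- The disjoint union `T ∪ M`; it does not carry the sum topology, but the one below. -/
def TripleBordification (M : Type*) : Type _ := DistinctTriple M ⊕ M

/-- A triple as a point of `T ∪ M`. -/
def TripleBordification.ofTriple {M : Type*} (x : DistinctTriple M) : TripleBordification M :=
  Sum.inl x

/-- A point of `M` as a point of `T ∪ M`. -/
def TripleBordification.ofPoint {M : Type*} (p : M) : TripleBordification M :=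
  Sum.inr p

/-- The set `Ũ ⊆ T ∪ M`: the points of `U` together with the triples that have at least two
components in `U`. -/
def TripleBordification.enlarge {M : Type*} (U : Set M) : Set (TripleBordification M) :=
  TripleBordification.ofTriple '' {x | ∃ i j : Fin 3, i ≠ j ∧ x.1 i ∈ U ∧ x.1 j ∈ U} ∪
    TripleBordification.ofPoint '' U

/-- Tukia's topology on `T ∪ M`, generated by the open sets of `T` and the sets `Ũ` for `U` open
in `M`. -/
instance TripleBordification.instTopologicalSpace (M : Type*) [TopologicalSpace M] :
    TopologicalSpace (TripleBordification M) :=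
  TopologicalSpace.generateFrom
    ({W | ∃ V : Set (DistinctTriple M), IsOpen V ∧ W = TripleBordification.ofTriple '' V} ∪
      {W | ∃ U : Set M, IsOpen U ∧ W = TripleBordification.enlarge U})

/-- The finite boundary `M_F` for the annulus system `𝒜`: the points `p ∈ M` that are limits, in
Tukia's topology on `T ∪ M`, of a `ρ`-bounded sequence of triples. -/
def finiteBoundary {M : Type*} [TopologicalSpace M] (𝒜 : Set (Annulus M)) : Set M :=
  {p | ∃ (x₀ : DistinctTriple M) (x : ℕ → DistinctTriple M) (R : ℕ),
    Tendsto (fun n => TripleBordification.ofTriple (x n)) atTop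
      (𝓝 (TripleBordification.ofPoint p)) ∧
    ∀ n, tripleDist 𝒜 x₀ (x n) ≤ R}

end Triples

end ConvergenceGroup

/-!
The proof uses no random walk; it rests on a nullity criterion for stationary measures.

Call a closed set `E ⊆ M` porous if there are finitely many nonempty open sets such that every
translate of `E` misses one of them. A porous set is `ν`-null. Indeed, the porous sets with a given
finite family of open sets form a `G`-invariant family which is closed under ultralimits, and `ν`
is upper semicontinuous along ultralimits of closed sets, so `ν` attains its supremum `s` on this
family at some `L`. The function `g ↦ ν (g⁻¹ L)` is `μ`-harmonic and attains its maximum, so it is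
constant (`IsStationary.measure_preimage_smul_eq`). But `L` misses an open set, so its translates
can be contracted into every neighbourhood of some point `c`
(`exists_forall_isOpen_smul_subset`). Hence `ν {c} ≥ s`, and `s = 0` because a stationary measure
has no atoms.

Given nonempty open sets `U`, `V` and points `y`, `z`, the set of the `p` such that no `h ∈ G` has
`h y, h z ∈ V` and `h p ∈ U` is closed and porous: any two points can be moved into `V`
simultaneously, and by compactness of `M × M` finitely many group elements do this for all pairs.
So almost every `p` admits such an `h` (`IsStationary.ae_exists_smul_mem`). Both claims follow.

* If `U` and `V` have disjoint closures and `y ≠ z`, almost every `p` admits infinitely many such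
  `h`. A convergent sequence of distinct ones has its attracting point in `closure V` but keeps `p`
  in `U`, so its repelling point is `p`; this makes `p` conical.
* A power `f` of the hyperbolic element satisfies `A < f A`, so `h y, h z ∈ int A⁻` together with
  `h p ∈ fⁿ int A⁺` yields the chain `h⁻¹ A < h⁻¹ f A < ⋯ < h⁻¹ fⁿ A` between `{y, z}` and `{p}`.
  Almost every `p` has such chains for all `n`. Only finitely many translates of `A` separate two
  given pairs of distinct points, so a bounded number of initial annuli can be dropped to obtain
  chains that start from two of the components of any given triple. Such a `p` is not in the finite
  boundary.
-/

namespace ConvergenceGroup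

/-! ### Convergence dynamics -/

section Dynamics

variable {G M : Type*} [Group G] [TopologicalSpace M] [MulAction G M]

theorem ConvergesOff.tendsto {h : ℕ → G} {a b x : M} (H : ConvergesOff h a b) (hx : x ≠ a) :
    Tendsto (fun n => h n • x) atTop (𝓝 b) := by
  rw [tendsto_nhds]
  intro U hU hb
  filter_upwards [H {x} isCompact_singleton (singleton_subset_iff.2 hx) U hU hb] with n hn
  exact hn rfl

/-- At least one of the points `p`, `q` is not the repelling point. -/
theorem ConvergesOff.mem_of_isClosed {h : ℕ → G} {a b p q : M} (H : ConvergesOff h a b)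
    {S : Set M} (hS : IsClosed S) (hpq : p ≠ q) (hp : ∀ n, h n • p ∈ S) (hq : ∀ n, h n • q ∈ S) :
    b ∈ S := by
  by_cases hpa : p = a
  · exact hS.mem_of_tendsto (H.tendsto (hpa ▸ hpq.symm)) (.of_forall hq)
  · exact hS.mem_of_tendsto (H.tendsto hpa) (.of_forall hp)

/-- The attracting point of a convergent sequence of such elements would lie in both `C` and
`D`. -/
theorem finite_setOf_smul_mem (hconv : IsConvergenceAction G M) {C D : Set M} (hC : IsClosed C)
    (hD : IsClosed D) (hCD : Disjoint C D) {y z v w : M} (hyz : y ≠ z) (hvw : v ≠ w) :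
    {h : G | (h • y ∈ C ∧ h • z ∈ C) ∧ h • v ∈ D ∧ h • w ∈ D}.Finite := by
  by_contra hinf
  rw [← Set.Infinite] at hinf
  obtain ⟨k, -, a, b, hab⟩ := hconv (fun n => (hinf.natEmbedding _ n : G))
    (fun m n h => (hinf.natEmbedding _).injective (Subtype.ext h))
  have hmem n := (hinf.natEmbedding _ (k n)).2
  exact disjoint_left.1 hCD
    (hab.mem_of_isClosed hC hyz (fun n => (hmem n).1.1) fun n => (hmem n).1.2)
    (hab.mem_of_isClosed hD hvw (fun n => (hmem n).2.1) fun n => (hmem n).2.2)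

theorem infinite_of_isOpen [CompactSpace M] [ContinuousConstSMul G M] [Infinite M]
    [MulAction.IsMinimal G M] {U : Set M} (hU : IsOpen U) (hne : U.Nonempty) : U.Infinite := by
  intro hfin
  obtain ⟨I, hI⟩ := isCompact_univ.exists_finite_cover_smul G hU hne
  refine infinite_univ ((I.finite_toSet.biUnion fun g _ => ?_).subset hI)
  exact hfin.image _

/-- In a minimal action, attracting and repelling points can be prescribed up to open sets. -/
theorem exists_convergesOff [ContinuousConstSMul G M] [Infinite G]
    (hconv : IsConvergenceAction G M) [MulAction.IsMinimal G M] {U V : Set M}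
    (hU : IsOpen U) (hUne : U.Nonempty) (hV : IsOpen V) (hVne : V.Nonempty) :
    ∃ (h : ℕ → G) (a b : M), a ∈ U ∧ b ∈ V ∧ ConvergesOff h a b := by
  obtain ⟨k, -, a, b, hab⟩ := hconv _ (Infinite.natEmbedding G).injective
  obtain ⟨γ, hγ⟩ := hU.exists_smul_mem G a hUne
  obtain ⟨δ, hδ⟩ := hV.exists_smul_mem G b hVne
  refine ⟨fun n => δ * (Infinite.natEmbedding G (k n)) * γ⁻¹, γ • a, δ • b, hγ, hδ, ?_⟩
  intro K hK hKa W hW hbW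
  have := hab ((fun x => γ⁻¹ • x) '' K) (hK.image (continuous_const_smul _)) ?_
    ((fun x => δ • x) ⁻¹' W) (hW.preimage (continuous_const_smul _)) hbW
  · filter_upwards [this] with n hn x hx
    simpa [mul_smul] using hn (mem_image_of_mem _ hx)
  · rintro _ ⟨x, hx, rfl⟩ (hxa : γ⁻¹ • x = a)
    exact hKa hx (by rw [← hxa, smul_inv_smul]; rfl)

/-- A convergent sequence of such `h` attracts into `closure V`; as it keeps `p` in `U`, its
repelling point must be `p`. -/
theorem isConicalLimitPoint_of_infinite [CompactSpace M]
    [TopologicalSpace.MetrizableSpace M] (hconv : IsConvergenceAction G M)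
    {U V : Set M} (hUV : Disjoint (closure U) (closure V)) {y z p : M} (hyz : y ≠ z)
    (hinf : {h : G | h • y ∈ V ∧ h • z ∈ V ∧ h • p ∈ U}.Infinite) : IsConicalLimitPoint G p := by
  obtain ⟨k, -, a, b, hab⟩ := hconv (fun n => (hinf.natEmbedding _ n : G))
    (fun m n h => (hinf.natEmbedding _).injective (Subtype.ext h))
  have hmem n := (hinf.natEmbedding _ (k n)).2
  have hb : b ∈ closure V := hab.mem_of_isClosed isClosed_closure hyz
    (fun n => subset_closure (hmem n).1) fun n => subset_closure (hmem n).2.1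
  obtain rfl : p = a := by
    by_contra hpa
    exact disjoint_left.1 hUV
      (mem_closure_of_tendsto (hab.tendsto hpa) (.of_forall fun n => (hmem n).2.2)) hb
  obtain ⟨a', ha', φ, hφ, hlim⟩ := (isClosed_closure (s := U)).isCompact.tendsto_subseq
    (fun n => subset_closure (hmem n).2.2)
  exact ⟨a', b, fun h => disjoint_left.1 hUV ha' (h ▸ hb), _, hlim,
    fun x hx => (hab.tendsto hx).comp hφ.tendsto_atTop⟩

/-- Proper closed sets can be contracted to a point. -/
theorem exists_forall_isOpen_smul_subset [CompactSpace M] [ContinuousConstSMul G M]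
    [Infinite G] (hconv : IsConvergenceAction G M) [MulAction.IsMinimal G M]
    {E : Set M} (hE : IsClosed E) (hne : Eᶜ.Nonempty) :
    ∃ b : M, ∀ W, IsOpen W → b ∈ W → ∃ h : G, E ⊆ (fun x => h • x) ⁻¹' W := by
  obtain ⟨h, a, b, ha, -, hab⟩ := exists_convergesOff hconv hE.isOpen_compl hne
    isOpen_univ (hne.mono (subset_univ _))
  refine ⟨b, fun W hW hbW => ?_⟩
  obtain ⟨n, hn⟩ := (hab E hE.isCompact
    (fun x hx hxa => ha ((mem_singleton_iff.1 hxa) ▸ hx)) W hW hbW).exists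
  exact ⟨h n, hn⟩

variable [T2Space M]

theorem infinite_of_isConvergenceAction [Infinite G] (hconv : IsConvergenceAction G M)
    (hne : IsNonElementary G M) [Nonempty M] : Infinite M := by
  by_contra hfin
  rw [not_infinite_iff_finite] at hfin
  obtain ⟨σ, hσ⟩ := Finite.exists_infinite_fiber (MulAction.toPermHom G M)
  obtain ⟨k, -, a, b, hab⟩ := hconv
    (fun n => (Infinite.natEmbedding (MulAction.toPermHom G M ⁻¹' {σ}) n : G))
    (fun m n h => (Infinite.natEmbedding _).injective (Subtype.ext h))
  -- All terms of the sequence act as the single permutation `σ`, so `σ` is constant off `a`.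
  have key : ∀ x, x ≠ a → σ x = b := by
    intro x hx
    have ht := hab.tendsto hx
    refine tendsto_nhds_unique (tendsto_const_nhds.congr fun n => ?_) ht
    have := (Infinite.natEmbedding (MulAction.toPermHom G M ⁻¹' {σ}) (k n)).2
    exact (DFunLike.congr_fun (this : MulAction.toPermHom G M _ = σ) x).symm
  refine hne univ univ_nonempty ?_ fun _ _ _ => mem_univ _
  have hsub : (univ : Set M) ⊆ {a, σ.symm b} := by
    intro x _
    by_cases hx : x = a
    · exact Or.inl hx
    · exact Or.inr (by rw [mem_singleton_iff, ← key x hx, Equiv.symm_apply_apply])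
  exact (encard_le_encard hsub).trans
    ((encard_insert_le _ _).trans (by rw [encard_singleton]; norm_num))

theorem infinite_orbit [Infinite M] [MulAction.IsMinimal G M] (x : M) :
    (MulAction.orbit G x).Infinite := by
  intro hfin
  have := (MulAction.dense_orbit G x).closure_eq
  rw [hfin.isClosed.closure_eq] at this
  exact infinite_univ (this ▸ hfin)

theorem exists_smul_mem_and_smul_mem [ContinuousConstSMul G M] [Infinite G] [Infinite M]
    (hconv : IsConvergenceAction G M) [MulAction.IsMinimal G M] {V : Set M} (hV : IsOpen V)
    (hVne : V.Nonempty) (y z : M) :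
    ∃ h : G, h • y ∈ V ∧ h • z ∈ V := by
  have hfin : ({y, z} : Set M).Finite := toFinite _
  obtain ⟨h, a, b, ha, hb, hab⟩ := exists_convergesOff hconv hfin.isClosed.isOpen_compl
    hfin.infinite_compl.nonempty hV hVne
  obtain ⟨n, hn⟩ := (hab {y, z} hfin.isCompact
    (fun x hx hxa => ha ((mem_singleton_iff.1 hxa) ▸ hx)) V hV hb).exists
  exact ⟨h n, hn (by simp), hn (by simp)⟩

end Dynamics

/-! ### Stationary measures -/

section Stationary

variable {G M : Type*} [Group G] [TopologicalSpace M] [MulAction G M] [ContinuousConstSMul G M]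
  [MeasurableSpace M] [BorelSpace M]

/-- The maximum principle for the harmonic function `g ↦ ν (g⁻¹ S)`. -/
theorem IsStationary.measure_preimage_smul_eq {μ : PMF G}
    (hμ : Subsemigroup.closure μ.support = ⊤) {ν : Measure M} [IsFiniteMeasure ν]
    (hν : IsStationary μ ν) {S : Set M} (hS : MeasurableSet S)
    (hmax : ∀ g : G, ν ((fun x => g • x) ⁻¹' S) ≤ ν S) (g : G) :
    ν ((fun x => g • x) ⁻¹' S) = ν S := by
  have key : ∀ k ∈ Subsemigroup.closure μ.support, ∀ t : G,
      ν ((fun x => t • x) ⁻¹' S) = ν S → ν ((fun x => (t * k) • x) ⁻¹' S) = ν S := by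
    intro k hk
    induction hk using Subsemigroup.closure_induction with
    | mem k hk =>
      intro t ht
      by_contra hlt
      have hlt := (hmax (t * k)).lt_of_ne hlt
      have hst := hν _ (hS.preimage (measurable_const_smul t))
      simp only [← preimage_comp, Function.comp_def, smul_smul] at hst
      have hsum : ∑' g, μ g * ν S = ν S := by rw [ENNReal.tsum_mul_right, μ.tsum_coe, one_mul]
      refine (ENNReal.tsum_lt_tsum (f := fun g => μ g * ν ((fun x => (t * g) • x) ⁻¹' S))
        (g := fun g => μ g * ν S) (i := k) ?_ (fun g => mul_le_mul_right (hmax _) _) ?_).ne ?_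
      · rw [← hst]; exact measure_ne_top _ _
      · exact (ENNReal.mul_lt_mul_iff_right ((PMF.mem_support_iff _ _).1 hk)
          (μ.apply_ne_top k)).2 hlt
      · rw [hsum, ← hst, ht]
    | mul k l _ _ hk hl =>
      intro t ht
      rw [← mul_assoc]
      exact hl _ (hk t ht)
  simpa using key g (hμ ▸ Subsemigroup.mem_top g) 1 (by simp)

/-- The points whose atoms have maximal mass would form a finite invariant set. -/
theorem IsStationary.measure_singleton [T2Space M] [Infinite M] [MulAction.IsMinimal G M]
    {μ : PMF G} (hμ : Subsemigroup.closure μ.support = ⊤) {ν : Measure M} [IsFiniteMeasure ν]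
    (hν : IsStationary μ ν) (p : M) : ν {p} = 0 := by
  by_contra hp
  have hfin : {q : M | ν {p} ≤ ν {q}}.Finite :=
    Measure.finite_const_le_meas_of_disjoint_iUnion ν (pos_iff_ne_zero.2 hp)
      (fun q => measurableSet_singleton q)
      (fun q r hqr => disjoint_singleton.2 hqr) (measure_ne_top _ _)
  obtain ⟨q, hq, hmax⟩ := hfin.exists_maximalFor (fun q => ν {q}) _ ⟨p, le_refl (ν {p})⟩
  have hle : ∀ r, ν {r} ≤ ν {q} := by
    intro r
    by_contra! h
    exact h.not_ge (hmax (hq.trans h.le) h.le)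
  have hpre : ∀ g : G, (fun x => g • x) ⁻¹' {q} = {g⁻¹ • q} := by
    intro g
    ext x
    simp [eq_inv_smul_iff]
  have heq := hν.measure_preimage_smul_eq hμ (measurableSet_singleton q)
    fun g => by rw [hpre]; exact hle _
  refine infinite_orbit (G := G) q (hfin.subset ?_)
  rintro _ ⟨g, rfl⟩
  have := heq g⁻¹
  rw [hpre, inv_inv] at this
  exact hq.trans this.ge

/-- The limit of a family of subsets of a compact space along an ultrafilter. The two properties
give upper semicontinuity of outer regular measures and the persistence of missed open sets. -/
theorem exists_isClosed_ultralimit {X ι : Type*} [TopologicalSpace X] [CompactSpace X]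
    (𝒰 : Ultrafilter ι) (E : ι → Set X) :
    ∃ L : Set X, IsClosed L ∧ (∀ W, IsOpen W → L ⊆ W → ∀ᶠ n in 𝒰, E n ⊆ W) ∧
      ∀ W, IsOpen W → (∀ᶠ n in 𝒰, Disjoint (E n) W) → Disjoint L W := by
  let O : Set (Set X) := {W | IsOpen W ∧ ∀ᶠ n in 𝒰, Disjoint (E n) W}
  refine ⟨(⋃₀ O)ᶜ, (isOpen_sUnion fun W hW => hW.1).isClosed_compl, fun W hW hLW => ?_,
    fun W hW hd => ?_⟩
  · obtain ⟨T, hTO, hTfin, hT⟩ := hW.isClosed_compl.isCompact.elim_finite_subcover_image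
      (b := O) (c := id) (fun s hs => hs.1) (sUnion_eq_biUnion ▸ compl_subset_comm.1 hLW)
    have : ∀ᶠ n in 𝒰, ∀ s ∈ T, Disjoint (E n) s :=
      (eventually_all_finite hTfin).2 fun s hs => (hTO hs).2
    filter_upwards [this] with n hn x hx
    by_contra hxW
    obtain ⟨s, hs, hxs⟩ := mem_iUnion₂.1 (hT hxW)
    exact disjoint_left.1 (hn s hs) hx hxs
  · exact (disjoint_compl_left_iff_subset).2 (subset_sUnion_of_mem ⟨hW, hd⟩)

variable [CompactSpace M] [TopologicalSpace.MetrizableSpace M]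

/-- Porous closed sets are null for a stationary measure. -/
theorem IsStationary.measure_eq_zero_of_porous [Infinite G] [Infinite M]
    (hconv : IsConvergenceAction G M) [MulAction.IsMinimal G M] {μ : PMF G}
    (hμ : Subsemigroup.closure μ.support = ⊤) {ν : Measure M} [IsFiniteMeasure ν]
    (hν : IsStationary μ ν) {ι : Type*} [Finite ι] {U : ι → Set M} (hU : ∀ i, IsOpen (U i))
    (hUne : ∀ i, (U i).Nonempty) {E : Set M} (hE : IsClosed E)
    (hEU : ∀ g : G, ∃ i, Disjoint E ((fun x => g • x) ⁻¹' U i)) : ν E = 0 := by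
  let F : Set (Set M) := {E | IsClosed E ∧ ∀ g : G, ∃ i, Disjoint E ((fun x => g • x) ⁻¹' U i)}
  have hFinv : ∀ L ∈ F, ∀ t : G, (fun x => t • x) ⁻¹' L ∈ F := by
    rintro L ⟨hL, hLU⟩ t
    refine ⟨hL.preimage (continuous_const_smul t), fun g => ?_⟩
    obtain ⟨i, hi⟩ := hLU (g * t⁻¹)
    refine ⟨i, disjoint_left.2 fun x hx hxU => disjoint_left.1 hi hx ?_⟩
    simpa [mul_smul] using hxU
  obtain ⟨u, -, hu, huF⟩ := exists_seq_tendsto_sSup (S := ν '' F) ⟨_, E, ⟨hE, hEU⟩, rfl⟩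
    (OrderTop.bddAbove _)
  choose D hDF hDu using huF
  obtain ⟨L, hL, hLsub, hLdisj⟩ := exists_isClosed_ultralimit (hyperfilter ℕ) D
  have hLF : L ∈ F := by
    refine ⟨hL, fun g => ?_⟩
    by_contra! hno
    have hall : ∀ i, ∀ᶠ n in hyperfilter ℕ, ¬ Disjoint (D n) ((fun x => g • x) ⁻¹' U i) := by
      intro i
      rw [Ultrafilter.eventually_not]
      exact fun h => hno i (hLdisj _ ((hU i).preimage (continuous_const_smul g)) h)
    obtain ⟨n, hn⟩ := (eventually_all.2 hall).exists
    obtain ⟨i, hi⟩ := (hDF n).2 g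
    exact hn i hi
  have hle : ∀ S ∈ F, ν S ≤ ν L := by
    intro S hS
    refine (le_sSup (mem_image_of_mem ν hS)).trans ?_
    rw [Set.measure_eq_iInf_isOpen L]
    refine le_iInf fun W => le_iInf fun hLW => le_iInf fun hW => ?_
    refine le_of_tendsto (hu.mono_left Nat.hyperfilter_le_atTop) ?_
    filter_upwards [hLsub W hW hLW] with n hn
    rw [← hDu]
    exact measure_mono hn
  have heq := hν.measure_preimage_smul_eq hμ hL.measurableSet fun g => hle _ (hFinv L hLF g)
  obtain ⟨i, hi⟩ := hLF.2 1
  have hLne : Lᶜ.Nonempty := by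
    obtain ⟨x, hx⟩ := hUne i
    exact ⟨x, fun hxL => disjoint_left.1 hi hxL (by simpa using hx)⟩
  obtain ⟨c, hc⟩ := exists_forall_isOpen_smul_subset hconv hL hLne
  have hatom : ν L ≤ ν {c} := by
    rw [Set.measure_eq_iInf_isOpen {c}]
    refine le_iInf fun W => le_iInf fun hcW => le_iInf fun hW => ?_
    obtain ⟨h, hh⟩ := hc W hW (hcW rfl)
    rw [← heq h⁻¹]
    refine measure_mono fun x hx => ?_
    simpa using hh hx
  rw [hν.measure_singleton hμ c] at hatom
  exact le_antisymm ((hle E ⟨hE, hEU⟩).trans hatom) zero_le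

/-- Almost every point can be moved into `U` while two given points are moved into `V`. -/
theorem IsStationary.ae_exists_smul_mem [Infinite G] [Infinite M]
    (hconv : IsConvergenceAction G M) [MulAction.IsMinimal G M] {μ : PMF G}
    (hμ : Subsemigroup.closure μ.support = ⊤) {ν : Measure M} [IsFiniteMeasure ν]
    (hν : IsStationary μ ν) {U V : Set M} (hU : IsOpen U) (hUne : U.Nonempty) (hV : IsOpen V)
    (hVne : V.Nonempty) (y z : M) :
    ∀ᵐ p ∂ν, ∃ h : G, h • y ∈ V ∧ h • z ∈ V ∧ h • p ∈ U := by
  obtain ⟨I, hI⟩ := isCompact_univ.elim_finite_subcover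
    (fun h : G => {q : M × M | h • q.1 ∈ V ∧ h • q.2 ∈ V})
    (fun h => (hV.preimage (continuous_fst.const_smul h)).inter
      (hV.preimage (continuous_snd.const_smul h)))
    (fun q _ => mem_iUnion.2 (exists_smul_mem_and_smul_mem hconv hV hVne q.1 q.2))
  refine hν.measure_eq_zero_of_porous hconv hμ (ι := I)
    (U := fun h => (fun x => (h : G) • x) ⁻¹' U)
    (fun h => hU.preimage (continuous_const_smul _)) (fun h => ?_) ?_ fun g => ?_
  · obtain ⟨x, hx⟩ := hUne
    exact ⟨(h : G)⁻¹ • x, by simpa using hx⟩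
  · have : {p : M | ∃ h : G, h • y ∈ V ∧ h • z ∈ V ∧ h • p ∈ U} =
        ⋃ h ∈ {h : G | h • y ∈ V ∧ h • z ∈ V}, (fun x => h • x) ⁻¹' U := by
      ext p
      simp [and_assoc]
    rw [this, isClosed_compl_iff]
    exact isOpen_biUnion fun h _ => hU.preimage (continuous_const_smul h)
  · obtain ⟨h, hh, hhV⟩ := mem_iUnion₂.1 (hI (mem_univ (g • y, g • z)))
    refine ⟨⟨h, hh⟩, disjoint_left.2 fun p hp hpU => hp ⟨h * g, ?_, ?_, ?_⟩⟩
    · simpa [mul_smul] using hhV.1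
    · simpa [mul_smul] using hhV.2
    · simpa [mul_smul] using hpU

/-! ### Almost every point is conical -/

theorem IsStationary.ae_isConicalLimitPoint [Countable G] [Infinite G] [Infinite M]
    (hconv : IsConvergenceAction G M) [MulAction.IsMinimal G M] {μ : PMF G}
    (hμ : Subsemigroup.closure μ.support = ⊤) {ν : Measure M} [IsFiniteMeasure ν]
    (hν : IsStationary μ ν) : ∀ᵐ p ∂ν, IsConicalLimitPoint G p := by
  obtain ⟨y, z, hyz⟩ := exists_pair_ne M
  obtain ⟨U, hyU, hU, V, hzV, hV, hUV⟩ := exists_open_nhds_disjoint_closure hyz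
  -- Removing the finite set `F • y` from `V` forces group elements outside `F`.
  have hF : ∀ F : Finset G, ∀ᵐ p ∂ν, ∃ h : G, h • y ∈ V \ ((fun h => h • y) '' (F : Set G)) ∧
      h • z ∈ V \ ((fun h => h • y) '' (F : Set G)) ∧ h • p ∈ U := fun F =>
    have hfin := F.finite_toSet.image fun h => h • y
    hν.ae_exists_smul_mem hconv hμ hU ⟨y, hyU⟩ (hV.sdiff hfin.isClosed)
      ((infinite_of_isOpen (G := G) hV ⟨z, hzV⟩).sdiff hfin).nonempty y z
  filter_upwards [ae_all_iff.2 hF] with p hp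
  refine isConicalLimitPoint_of_infinite hconv hUV hyz fun hfin => ?_
  obtain ⟨h, hy, hz, hpU⟩ := hp hfin.toFinset
  exact hy.2 ⟨h, by simpa using ⟨hy.1, hz.1, hpU⟩, rfl⟩

end Stationary

/-! ### Chains of annuli -/

section Chains

variable {M : Type*} [TopologicalSpace M]

theorem le_crossratio_of_chain {𝒜 : Set (Annulus M)} {K L : Set M} (B : ℕ → Annulus M) (R : ℕ)
    (hB : ∀ i, B i ∈ 𝒜) (hlt : ∀ i, (B i).Precedes (B (i + 1))) (hK : K ⊆ interior (B 0).neg)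
    (hL : L ⊆ interior (B R).pos) : ((R + 1 : ℕ) : ℕ∞) ≤ crossratio 𝒜 K L := by
  have hchain : IsAnnulusChain 𝒜 K L ((List.range (R + 1)).map B) := by
    refine ⟨?_, ?_, ?_, ?_⟩
    · intro A hA
      obtain ⟨i, -, rfl⟩ := List.mem_map.1 hA
      exact hB i
    · simpa [List.range_succ_eq_map] using hK
    · rw [List.isChain_map, List.isChain_range]
      exact fun i _ => hlt i
    · simpa [List.range_succ] using hL
  have := le_iSup₂ (f := fun (l : List (Annulus M)) (_ : IsAnnulusChain 𝒜 K L l) =>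
    (l.length : ℕ∞)) _ hchain
  simpa [crossratio] using this

theorem crossratio_le_tripleDist (𝒜 : Set (Annulus M)) (x y : DistinctTriple M) {i j k l : Fin 3}
    (hij : i ≠ j) (hkl : k ≠ l) :
    crossratio 𝒜 {x.1 i, x.1 j} {y.1 k, y.1 l} ≤ tripleDist 𝒜 x y :=
  le_iSup_of_le i <| le_iSup_of_le j <| le_iSup_of_le k <| le_iSup_of_le l <|
    le_iSup_of_le hij <| le_iSup_of_le hkl le_rfl

theorem Annulus.Precedes.mem_interior_neg {A B : Annulus M} (h : A.Precedes B) {x : M}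
    (hx : x ∉ interior A.pos) : x ∈ interior B.neg :=
  (h.symm ▸ mem_univ x : x ∈ interior A.pos ∪ interior B.neg).resolve_left hx

theorem Annulus.Precedes.mem_interior_pos {A B : Annulus M} (h : A.Precedes B) {x : M}
    (hx : x ∉ interior B.neg) : x ∈ interior A.pos :=
  (h.symm ▸ mem_univ x : x ∈ interior A.pos ∪ interior B.neg).resolve_right hx

theorem mem_interior_neg_of_chain {B : ℕ → Annulus M} (hlt : ∀ i, (B i).Precedes (B (i + 1)))
    {x : M} (hx : x ∈ interior (B 0).neg) (t : ℕ) : x ∈ interior (B t).neg := by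
  induction t with
  | zero => exact hx
  | succ t ih =>
    exact (hlt t).mem_interior_neg fun h =>
      disjoint_left.1 (B t).disjoint (interior_subset ih) (interior_subset h)

theorem mem_interior_pos_of_chain {B : ℕ → Annulus M} (hlt : ∀ i, (B i).Precedes (B (i + 1)))
    {x : M} {s t : ℕ} (hst : s ≤ t) (hx : x ∈ interior (B t).pos) : x ∈ interior (B s).pos := by
  induction t, hst using Nat.le_induction with
  | base => exact hx
  | succ t _ ih =>
    exact ih ((hlt t).mem_interior_pos fun h =>
      disjoint_left.1 (B (t + 1)).disjoint (interior_subset h) (interior_subset hx))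

variable {G : Type*} [Group G] [MulAction G M]

/-- If `f` maps the complement of `int A⁻` into `int A⁺`, then positive powers of `f` move the
points outside `A⁻ ∪ A⁺`, so `f` has infinite order. -/
theorem Annulus.pow_injective {A : Annulus M} {f : G}
    (hf : ∀ x, x ∉ interior A.neg → f • x ∈ interior A.pos) :
    Function.Injective fun n : ℕ => f ^ n := by
  rw [injective_pow_iff_not_isOfFinOrder, isOfFinOrder_iff_pow_eq_one]
  rintro ⟨n, hn, hfn⟩
  obtain ⟨w, hw⟩ := A.compl_nonempty
  rw [compl_union] at hw
  have key : ∀ n : ℕ, f ^ (n + 1) • w ∈ interior A.pos := by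
    intro n
    induction n with
    | zero => simpa using hf w fun h => hw.1 (interior_subset h)
    | succ n ih =>
      rw [pow_succ', mul_smul]
      exact hf _ fun h => disjoint_left.1 A.disjoint (interior_subset h) (interior_subset ih)
  have := key (n - 1)
  rw [Nat.sub_add_cancel hn, hfn, one_smul] at this
  exact hw.2 (interior_subset this)

variable [ContinuousConstSMul G M]

theorem mem_interior_image_smul_iff {g : G} {S : Set M} {x : M} :
    x ∈ interior ((fun x => g • x) '' S) ↔ g⁻¹ • x ∈ interior S := by
  rw [← Set.mem_smul_set_iff_inv_smul_mem]
  exact Set.ext_iff.1 ((Homeomorph.smul g).image_interior S).symm x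

theorem Annulus.translate_precedes {A : Annulus M} {f : G}
    (hf : ∀ x, x ∉ interior A.neg → f • x ∈ interior A.pos) (k : G) :
    (A.translate k).Precedes (A.translate (k * f)) := by
  refine eq_univ_of_forall fun x => ?_
  by_cases hx : (k * f)⁻¹ • x ∈ interior A.neg
  · exact Or.inr (mem_interior_image_smul_iff.2 hx)
  · refine Or.inl (mem_interior_image_smul_iff.2 ?_)
    simpa [mul_smul] using hf _ hx

/-- A point that is reached from a fixed pair `y ≠ z` by the chains
`h⁻¹ A < h⁻¹ f A < ⋯ < h⁻¹ fⁿ A`, for all `n`, is not in the finite boundary. -/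
theorem notMem_finiteBoundary [T2Space M] [CompactSpace M] (hconv : IsConvergenceAction G M)
    {A : Annulus M} {f : G} (hf : ∀ x, x ∉ interior A.neg → f • x ∈ interior A.pos) {y z p : M}
    (hyz : y ≠ z) (hp : ∀ n : ℕ, ∃ h : G, h • y ∈ interior A.neg ∧ h • z ∈ interior A.neg ∧
      (f ^ n)⁻¹ • h • p ∈ interior A.pos) :
    p ∉ finiteBoundary (annulusSystem G A) := by
  rintro ⟨x₀, x, R, hlim, hR⟩
  -- The translates of `A` that separate `{y, z}` from two components of `x₀`.
  let S : Set G := ⋃ q ∈ {q : Fin 3 × Fin 3 | q.1 ≠ q.2},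
    {h : G | (h • y ∈ A.neg ∧ h • z ∈ A.neg) ∧ h • x₀.1 q.1 ∈ A.pos ∧ h • x₀.1 q.2 ∈ A.pos}
  have hS : S.Finite := (toFinite _).biUnion fun q hq =>
    finite_setOf_smul_mem hconv A.isClosed_neg A.isClosed_pos A.disjoint hyz (x₀.2.ne hq)
  let N := hS.toFinset.card
  obtain ⟨h, hy, hz, hph⟩ := hp (N + 1 + R)
  let B : ℕ → Annulus M := fun i => A.translate (h⁻¹ * f ^ i)
  have hlt : ∀ i, (B i).Precedes (B (i + 1)) := fun i => by
    have := Annulus.translate_precedes hf (h⁻¹ * f ^ i)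
    rwa [mul_assoc, ← pow_succ] at this
  have hneg : ∀ {i v}, v ∈ interior (B i).neg ↔ ((f ^ i)⁻¹ * h) • v ∈ interior A.neg := by
    intro i v
    simpa [B, Annulus.translate] using mem_interior_image_smul_iff (g := h⁻¹ * f ^ i)
  have hpos : ∀ {i v}, v ∈ interior (B i).pos ↔ ((f ^ i)⁻¹ * h) • v ∈ interior A.pos := by
    intro i v
    simpa [B, Annulus.translate] using mem_interior_image_smul_iff (g := h⁻¹ * f ^ i)
  have hy0 : y ∈ interior (B 0).neg := hneg.2 (by simpa using hy)
  have hz0 : z ∈ interior (B 0).neg := hneg.2 (by simpa using hz)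
  have hpB : p ∈ interior (B (N + 1 + R)).pos := hpos.2 (by simpa [mul_smul] using hph)
  obtain ⟨i, j, hij, hiff⟩ : ∃ i j : Fin 3, i ≠ j ∧
      (x₀.1 i ∈ interior (B N).pos ↔ x₀.1 j ∈ interior (B N).pos) := by
    classical
    obtain ⟨i, j, hij, h⟩ := Fintype.exists_ne_map_eq_of_card_lt
      (fun i : Fin 3 => decide (x₀.1 i ∈ interior (B N).pos)) (by simp)
    exact ⟨i, j, hij, by simpa using h⟩
  by_cases hi : x₀.1 i ∈ interior (B N).pos
  · -- The annuli `B 0, …, B N` all come from `S`, which has only `N` elements.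
    have hj := hiff.1 hi
    have hmaps : ∀ t ∈ Finset.range (N + 1), (f ^ t)⁻¹ * h ∈ hS.toFinset := by
      intro t ht
      have htN := Nat.lt_succ_iff.1 (Finset.mem_range.1 ht)
      refine hS.mem_toFinset.2 (mem_biUnion (x := (i, j)) hij ⟨⟨?_, ?_⟩, ?_, ?_⟩)
      · exact interior_subset (hneg.1 (mem_interior_neg_of_chain hlt hy0 t))
      · exact interior_subset (hneg.1 (mem_interior_neg_of_chain hlt hz0 t))
      · exact interior_subset (hpos.1 (mem_interior_pos_of_chain hlt htN hi))
      · exact interior_subset (hpos.1 (mem_interior_pos_of_chain hlt htN hj))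
    have hcard := Finset.card_le_card_of_injOn (fun t => (f ^ t)⁻¹ * h) hmaps
      fun s _ t _ hst => Annulus.pow_injective hf (inv_injective (mul_right_cancel hst))
    simp [N] at hcard
  · have hj := hiff.not.1 hi
    -- Tukia neighbourhoods: eventually two components of `x n` lie in the last annulus.
    have hopen : IsOpen (TripleBordification.enlarge (interior (B (N + 1 + R)).pos)) :=
      TopologicalSpace.isOpen_generateFrom_of_mem (Or.inr ⟨_, isOpen_interior, rfl⟩)
    obtain ⟨n, hn⟩ := (hlim.eventually (hopen.mem_nhds (Or.inr ⟨p, hpB, rfl⟩))).exists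
    obtain ⟨k, l, hkl, hk, hl⟩ : ∃ k l : Fin 3, k ≠ l ∧
        (x n).1 k ∈ interior (B (N + 1 + R)).pos ∧ (x n).1 l ∈ interior (B (N + 1 + R)).pos := by
      rcases hn with ⟨x', hx', he⟩ | ⟨q, -, he⟩
      · exact (Sum.inl_injective he) ▸ hx'
      · exact (Sum.inr_ne_inl he).elim
    have hle := (le_crossratio_of_chain (𝒜 := annulusSystem G A) (K := {x₀.1 i, x₀.1 j})
      (L := {(x n).1 k, (x n).1 l}) (fun t => B (N + 1 + t)) R (fun t => ⟨_, Or.inl rfl⟩)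
      (fun t => hlt _)
      (pair_subset ((hlt N).mem_interior_neg hi) ((hlt N).mem_interior_neg hj))
      (pair_subset hk hl)).trans ((crossratio_le_tripleDist _ _ _ hij hkl).trans (hR n))
    exact absurd (Nat.cast_le.1 hle) (by omega)

end Chains

end ConvergenceGroup

theorem mainTheorem4 {G M : Type*} [Group G] [Countable G] [Infinite G]
    [TopologicalSpace M] [CompactSpace M] [TopologicalSpace.MetrizableSpace M]
    [MeasurableSpace M] [BorelSpace M]
    [MulAction G M] [ContinuousConstSMul G M]
    (hconv : ConvergenceGroup.IsConvergenceAction G M)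
    (hne : ConvergenceGroup.IsNonElementary G M)
    (hmin : MulAction.IsMinimal G M)
    (μ : PMF G) (hμ : Subsemigroup.closure μ.support = ⊤)
    (ν : Measure M) [IsProbabilityMeasure ν] (hν : ConvergenceGroup.IsStationary μ ν) :
    (∀ (g : G) (a b : M) (A : ConvergenceGroup.Annulus M),
      ConvergenceGroup.IsHyperbolicElement g a b →
      a ∈ interior A.neg → b ∈ interior A.pos →
      ν (ConvergenceGroup.finiteBoundary (ConvergenceGroup.annulusSystem G A)) = 0) ∧
    ν {p : M | ConvergenceGroup.IsConicalLimitPoint G p}ᶜ = 0 := by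
  have : Nonempty M := nonempty_of_isProbabilityMeasure ν
  have : Infinite M := ConvergenceGroup.infinite_of_isConvergenceAction hconv hne
  refine ⟨?_, hν.ae_isConicalLimitPoint hconv hμ⟩
  intro g a b A hg ha hb
  -- Some power of `g` maps the complement of `int A⁻` into `int A⁺`.
  obtain ⟨m, hm⟩ := (hg.2.2.2 (interior A.neg)ᶜ isOpen_interior.isClosed_compl.isCompact
    (fun x hx hxa => hx ((mem_singleton_iff.1 hxa) ▸ ha)) _ isOpen_interior hb).exists
  obtain ⟨y, z, hyz⟩ := exists_pair_ne M
  have hae : ∀ n : ℕ, ∀ᵐ p ∂ν, ∃ h : G, h • y ∈ interior A.neg ∧ h • z ∈ interior A.neg ∧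
      h • p ∈ (fun x => ((g ^ m) ^ n)⁻¹ • x) ⁻¹' interior A.pos := fun n =>
    hν.ae_exists_smul_mem hconv hμ (isOpen_interior.preimage (continuous_const_smul _))
      ⟨(g ^ m) ^ n • b, by simpa using hb⟩ isOpen_interior ⟨a, ha⟩ y z
  rw [measure_eq_zero_iff_ae_notMem]
  filter_upwards [ae_all_iff.2 hae] with p hp
  exact ConvergenceGroup.notMem_finiteBoundary hconv (fun x hx => hm hx) hyz hp
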